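/- Let $X$ be a complex Hilbert space and let $A\colon D(A)\subseteq X\to X$ be a densely defined, closed linear operator that is skew-symmetric, i.e., $A\subseteq -A^{\star}$. Let $(H,\Gamma_1,\Gamma_2)$ be a boundary triplet for $A$, i.e., $H$ is a complex Hilbert space and $\Gamma_1,\Gamma_2\colon D(-A^{\star})=D(A^{\star})\to H$ are linear maps such that $$\langle A^{\star}x,y\rangle_X+\langle x,A^{\star}y\rangle_X=\langle\Gamma_1x,\Gamma_2y\rangle_H+\langle\Gamma_2x,\Gamma_1y\rangle_H\quad\text{for all }x,y\in D(A^{\star}),$$ and such that for all $y_1,y_2\in H$ there is $x\in D(A^{\star})$ with $\Gamma_1x=y_1$ and $\Gamma_2x=y_2$. Let the linear operator $B\colon D(B)\subseteq X\to X$ be an extension of $A$. Then $B$ generates a $C_0$-semigroup of contractions on $X$ if and only if there exists a unique $K\in L(H)$ with $\|K\|_{L(H)}\leqslant 1$ such that $$D(B)=\{x\in D(-A^{\star})\;:\;(K-1)\Gamma_1x+(K+1)\Gamma_2x=0\}\quad\text{and}\quad B=-A^{\star}|_{D(B)}.$$ -/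

import Mathlib

open Filter Topology
open scoped NNReal LinearPMap

/-- A linear operator `A` in a complex Hilbert space is skew-symmetric if it is densely defined
and `A ⊆ -A*`. -/
def IsSkewSymmetric {X : Type*} [NormedAddCommGroup X] [InnerProductSpace ℂ X] [CompleteSpace X]
    (A : X →ₗ.[ℂ] X) : Prop :=
  Dense (A.domain : Set X) ∧ A ≤ -A†

/-- `(H, Γ₁, Γ₂)` is a boundary triplet for `A`; the maps `Γ₁`, `Γ₂` are linear on
`D(-A*) = D(A*)`. Mathlib's inner product is linear in the second argument; taking complex
conjugates of both sides shows that the first condition does not depend on this convention. -/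
structure IsBoundaryTriplet {X H : Type*}
    [NormedAddCommGroup X] [InnerProductSpace ℂ X] [CompleteSpace X]
    [NormedAddCommGroup H] [InnerProductSpace ℂ H]
    (A : X →ₗ.[ℂ] X) (Γ₁ Γ₂ : A†.domain →ₗ[ℂ] H) : Prop where
  green : ∀ x y : A†.domain,
    inner ℂ (A† x) (y : X) + inner ℂ (x : X) (A† y)
      = inner ℂ (Γ₁ x) (Γ₂ y) + inner ℂ (Γ₂ x) (Γ₁ y)
  surjective : ∀ y₁ y₂ : H, ∃ x : A†.domain, Γ₁ x = y₁ ∧ Γ₂ x = y₂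

/-- A C₀-semigroup (strongly continuous one-parameter semigroup) of bounded operators. -/
structure IsC0Semigroup {X : Type*} [NormedAddCommGroup X] [NormedSpace ℂ X]
    (T : ℝ≥0 → X →L[ℂ] X) : Prop where
  map_zero : T 0 = ContinuousLinearMap.id ℂ X
  map_add : ∀ s t : ℝ≥0, T (s + t) = (T s).comp (T t)
  tendsto_zero : ∀ x : X, Tendsto (fun t : ℝ≥0 => T t x) (𝓝 0) (𝓝 x)

/-- `B` is the (infinitesimal) generator of `T`: `x ∈ D(B)` and `B x = y` hold if and only if
`(T t x - x) / t → y` as `t → 0+`. -/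
def IsSemigroupGenerator {X : Type*} [NormedAddCommGroup X] [NormedSpace ℂ X]
    (B : X →ₗ.[ℂ] X) (T : ℝ≥0 → X →L[ℂ] X) : Prop :=
  ∀ x y : X, (x, y) ∈ B.graph ↔
    Tendsto (fun t : ℝ≥0 => (((t : ℝ) : ℂ)⁻¹) • (T t x - x)) (𝓝[>] 0) (𝓝 y)

/-- `B` generates a C₀-semigroup of contractions. -/
def GeneratesContractionSemigroup {X : Type*} [NormedAddCommGroup X] [NormedSpace ℂ X]
    (B : X →ₗ.[ℂ] X) : Prop :=
  ∃ T : ℝ≥0 → X →L[ℂ] X,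
    IsC0Semigroup T ∧ (∀ t : ℝ≥0, ‖T t‖ ≤ 1) ∧ IsSemigroupGenerator B T

/-! Green's identity on the diagonal and polarization give 4 Re⟨A†x, x⟩ = ‖Γ₁x + Γ₂x‖² - ‖Γ₁x -
Γ₂x‖². Hence a restriction of -A† is dissipative exactly when Γ₁x + Γ₂x ↦ Γ₁x - Γ₂x is a
well-defined contraction on its boundary values. Such a map extends to a contraction K on H, and
K(Γ₁ + Γ₂) = Γ₁ - Γ₂ is the stated boundary condition rearranged.

If B generates a contraction semigroup, it is dissipative and 1 - B is onto. Being a dissipative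
extension of A, it lies below -A† (`IsSkewSymmetric.le_neg_adjoint`), hence below the dissipative
operator given by some K, and maximality (`eq_of_le`) forces equality.

Conversely, the operator given by a contraction K is dissipative and densely defined;
`surjective_smul_sub_boundaryConditionOperator` supplies the range condition, and Lumer–Phillips,
proved here by Yosida approximation, gives the semigroup. Uniqueness of K comes from joint
surjectivity of (Γ₁, Γ₂). -/

/-- A linear operator in a complex Hilbert space is dissipative if `Re ⟪B x, x⟫ ≤ 0` on its
domain. -/
def LinearPMap.IsDissipative {X : Type*} [NormedAddCommGroup X] [InnerProductSpace ℂ X]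
    (B : X →ₗ.[ℂ] X) : Prop :=
  ∀ x y : X, (x, y) ∈ B.graph → (inner ℂ y x).re ≤ 0

/-! ### Dissipative operators: lower bound, maximality, resolvent. -/

namespace LinearPMap.IsDissipative

variable {X : Type*} [NormedAddCommGroup X] [InnerProductSpace ℂ X] {B : X →ₗ.[ℂ] X}

/-- Dissipativity gives r‖x‖² ≤ Re⟨rx - y, x⟩; conclude by Cauchy–Schwarz. -/
theorem mul_norm_le (hB : B.IsDissipative) (r : ℝ) {x y : X}
    (h : (x, y) ∈ B.graph) : r * ‖x‖ ≤ ‖(r : ℂ) • x - y‖ := by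
  rcases eq_or_lt_of_le (norm_nonneg x) with h0 | hx
  · rw [← h0]; simp
  have h1 : r * ‖x‖ * ‖x‖ ≤ (inner ℂ ((r : ℂ) • x - y) x).re := by
    have h2 := hB x y h
    rw [inner_sub_left, inner_smul_left, inner_self_eq_norm_sq_to_K, Complex.sub_re]
    have : ((starRingEnd ℂ) (r : ℂ) * ((‖x‖ : ℂ)) ^ 2).re = r * ‖x‖ * ‖x‖ := by
      rw [Complex.conj_ofReal]; norm_cast; ring
    simp only [Complex.coe_algebraMap] at *
    linarith
  have h3 : (inner ℂ ((r : ℂ) • x - y) x).re ≤ ‖(r : ℂ) • x - y‖ * ‖x‖ :=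
    (Complex.re_le_norm _).trans (norm_inner_le_norm _ _)
  exact le_of_mul_le_mul_right (h1.trans h3) hx

theorem fst_eq (hB : B.IsDissipative) {r : ℝ} (hr : 0 < r) {x y x' y' : X}
    (h : (x, y) ∈ B.graph) (h' : (x', y') ∈ B.graph)
    (he : (r : ℂ) • x - y = (r : ℂ) • x' - y') : x = x' := by
  have h1 := hB.mul_norm_le r (B.graph.sub_mem h h')
  have h2 : (r : ℂ) • (x - x') - (y - y') = 0 := by
    rw [smul_sub, ← sub_eq_zero.mpr he]; abel
  simp only at h1
  rw [h2, norm_zero] at h1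
  have : ‖x - x'‖ ≤ 0 := by
    by_contra hc
    push Not at hc
    nlinarith [mul_pos hr hc]
  exact sub_eq_zero.mp (norm_le_zero_iff.mp this)

/-- A dissipative operator `B` such that `1 - B` is surjective has no proper dissipative
extension. -/
theorem eq_of_le {C : X →ₗ.[ℂ] X} (hC : C.IsDissipative) (hBC : B ≤ C)
    (hs : ∀ z : X, ∃ x y, (x, y) ∈ B.graph ∧ x - y = z) : B = C := by
  refine LinearPMap.eq_of_eq_graph (le_antisymm (LinearPMap.le_graph_of_le hBC) ?_)
  rintro ⟨x, y⟩ h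
  obtain ⟨x', y', h', he⟩ := hs (x - y)
  have h'' := LinearPMap.le_graph_of_le hBC h'
  have hx : x = x' := hC.fst_eq one_pos h h'' (by simpa using he.symm)
  subst hx
  rwa [C.mem_graph_snd_inj h h'' rfl]

/-- The resolvent of a dissipative operator. -/
theorem exists_resolvent (hB : B.IsDissipative) {r : ℝ} (hr : 0 < r)
    (hs : ∀ z : X, ∃ x y, (x, y) ∈ B.graph ∧ (r : ℂ) • x - y = z) :
    ∃ R : X →L[ℂ] X, (∀ z, (R z, (r : ℂ) • R z - z) ∈ B.graph) ∧ (∀ z, r * ‖R z‖ ≤ ‖z‖) ∧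
      ∀ x y, (x, y) ∈ B.graph → R ((r : ℂ) • x - y) = x := by
  choose f g hfg he using hs
  have hg : ∀ z, g z = (r : ℂ) • f z - z := fun z => by
    nth_rewrite 3 [← he z]; abel
  have hmem : ∀ z, (f z, (r : ℂ) • f z - z) ∈ B.graph := fun z => hg z ▸ hfg z
  have hinv : ∀ x y, (x, y) ∈ B.graph → f ((r : ℂ) • x - y) = x := fun x y h =>
    hB.fst_eq hr (hmem _) h (by abel)
  have hbound : ∀ z, r * ‖f z‖ ≤ ‖z‖ := fun z => by
    have := hB.mul_norm_le r (hmem z)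
    rwa [sub_sub_cancel] at this
  -- Linearity follows from uniqueness: both sides solve the same resolvent equation.
  let L : X →ₗ[ℂ] X :=
    { toFun := f
      map_add' := fun a b => by
        refine hB.fst_eq hr (hmem _) (B.graph.add_mem (hmem a) (hmem b)) ?_
        simp only [smul_add]; abel
      map_smul' := fun c a => by
        refine hB.fst_eq hr (hmem _) (B.graph.smul_mem c (hmem a)) ?_
        simp only [smul_sub, RingHom.id_apply, smul_comm c (r : ℂ)]; abel }
  refine ⟨L.mkContinuous r⁻¹ fun z => ?_, hmem, hbound, hinv⟩
  rw [inv_mul_eq_div, le_div_iff₀ hr, mul_comm]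
  exact hbound z

end LinearPMap.IsDissipative

/-! ### Exponentials of bounded operators. -/

section Exponential

variable {X : Type*} [NormedAddCommGroup X] [NormedSpace ℂ X] [CompleteSpace X]

theorem hasDerivAt_exp_ofReal_smul_apply (P : X →L[ℂ] X) (x : X) (s : ℝ) :
    HasDerivAt (fun t : ℝ => NormedSpace.exp ((t : ℂ) • P) x)
      (NormedSpace.exp ((s : ℂ) • P) (P x)) s := by
  have h := (hasDerivAt_exp_smul_const P (s : ℂ)).scomp s (Complex.ofRealCLM.hasDerivAt)
  have h2 := ((ContinuousLinearMap.apply ℂ X x).restrictScalars ℝ).hasFDerivAt.comp_hasDerivAt s h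
  simpa [Function.comp_def] using h2

theorem exp_ofReal_add_smul (P : X →L[ℂ] X) (s t : ℝ) :
    NormedSpace.exp (((s + t : ℝ) : ℂ) • P) =
      NormedSpace.exp ((s : ℂ) • P) * NormedSpace.exp ((t : ℂ) • P) := by
  let _ : NormedAlgebra ℚ (X →L[ℂ] X) := NormedAlgebra.restrictScalars ℚ ℂ _
  rw [← NormedSpace.exp_add_of_commute
    (((Commute.refl P).smul_left _).smul_right _), ← add_smul, Complex.ofReal_add]

/-- Two commuting bounded generators of contraction semigroups: the semigroups differ by at most
`t ‖P x - Q x‖` at `x`. -/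
theorem norm_exp_smul_sub_exp_smul_le {P Q : X →L[ℂ] X} (hPQ : Commute P Q)
    (hP : ∀ t : ℝ, 0 ≤ t → ∀ x, ‖NormedSpace.exp ((t : ℂ) • P) x‖ ≤ ‖x‖)
    (hQ : ∀ t : ℝ, 0 ≤ t → ∀ x, ‖NormedSpace.exp ((t : ℂ) • Q) x‖ ≤ ‖x‖)
    {t : ℝ} (ht : 0 ≤ t) (x : X) :
    ‖NormedSpace.exp ((t : ℂ) • P) x - NormedSpace.exp ((t : ℂ) • Q) x‖ ≤ t * ‖P x - Q x‖ := by
  let _ : NormedAlgebra ℚ (X →L[ℂ] X) := NormedAlgebra.restrictScalars ℚ ℂ _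
  -- The difference is the increment over [0, t] of s ↦ exp(sP) exp((t-s)Q) x. In the form
  -- exp(s(P-Q)) exp(tQ) x only one factor depends on s, while the first form shows that the
  -- derivative is at most ‖Px - Qx‖.
  have hsplit : ∀ s : ℝ, NormedSpace.exp ((s : ℂ) • (P - Q)) * NormedSpace.exp ((t : ℂ) • Q) =
      NormedSpace.exp ((s : ℂ) • P) * NormedSpace.exp (((t - s : ℝ) : ℂ) • Q) := fun s => by
    have hc : Commute (P - Q) Q := hPQ.sub_left (Commute.refl Q)
    rw [← NormedSpace.exp_add_of_commute ((hc.smul_left _).smul_right _),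
      ← NormedSpace.exp_add_of_commute ((hPQ.smul_left _).smul_right _)]
    congr 1
    rw [Complex.ofReal_sub, smul_sub, sub_smul]; abel
  have hcomm : Commute (P - Q) (NormedSpace.exp ((t : ℂ) • Q)) :=
    ((hPQ.sub_left (Commute.refl Q)).smul_right _).exp_right
  have key := norm_image_sub_le_of_norm_deriv_le_segment' (a := 0) (b := t)
    (f := fun s : ℝ => NormedSpace.exp ((s : ℂ) • (P - Q)) (NormedSpace.exp ((t : ℂ) • Q) x))
    (f' := fun s : ℝ => NormedSpace.exp ((s : ℂ) • (P - Q))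
      ((P - Q) (NormedSpace.exp ((t : ℂ) • Q) x)))
    (C := ‖P x - Q x‖)
    (fun s _ => (hasDerivAt_exp_ofReal_smul_apply (P - Q) _ s).hasDerivWithinAt)
    (fun s hs => by
      have e1 : (P - Q) (NormedSpace.exp ((t : ℂ) • Q) x) =
          NormedSpace.exp ((t : ℂ) • Q) ((P - Q) x) := congrArg (fun L : X →L[ℂ] X => L x) hcomm.eq
      have e2 := congrArg (fun L : X →L[ℂ] X => L ((P - Q) x)) (hsplit s)
      simp only [mul_apply_eq_comp] at e2
      rw [e1, e2]
      exact (hP s hs.1 _).trans (hQ (t - s) (by linarith [hs.2]) _)) t ⟨ht, le_rfl⟩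
  have e3 := congrArg (fun L : X →L[ℂ] X => L x) (hsplit t)
  simp only [mul_apply_eq_comp] at e3
  rw [e3] at key
  simpa [NormedSpace.exp_zero, mul_comm] using key

end Exponential

/-- A bounded dissipative operator generates a contraction semigroup. -/
theorem norm_exp_smul_apply_le_of_dissipative {X : Type*} [NormedAddCommGroup X]
    [InnerProductSpace ℂ X] [CompleteSpace X] {P : X →L[ℂ] X}
    (hP : ∀ x, (inner ℂ (P x) x).re ≤ 0) {t : ℝ} (ht : 0 ≤ t) (x : X) :
    ‖NormedSpace.exp ((t : ℂ) • P) x‖ ≤ ‖x‖ := by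
  let _ : NormedAlgebra ℚ (X →L[ℂ] X) := NormedAlgebra.restrictScalars ℚ ℂ _
  have hcomm : ∀ s : ℝ, NormedSpace.exp ((s : ℂ) • P) (P x) =
      P (NormedSpace.exp ((s : ℂ) • P) x) := fun s =>
    congrArg (fun L : X →L[ℂ] X => L x) (((Commute.refl P).smul_left (s : ℂ)).exp_left).eq
  -- The squared norm of the orbit has derivative 2 Re⟨Pv, v⟩ ≤ 0 at the orbit point v.
  let f : ℝ → ℝ := fun s =>
    (inner ℂ (NormedSpace.exp ((s : ℂ) • P) x) (NormedSpace.exp ((s : ℂ) • P) x)).re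
  have hd : ∀ s : ℝ, HasDerivAt f (2 * (inner ℂ (P (NormedSpace.exp ((s : ℂ) • P) x))
      (NormedSpace.exp ((s : ℂ) • P) x)).re) s := fun s => by
    have h := hasDerivAt_exp_ofReal_smul_apply P x s
    have h2 := Complex.reCLM.hasFDerivAt.comp_hasDerivAt s (h.inner ℂ h)
    refine h2.congr_deriv ?_
    rw [hcomm, map_add, ← inner_conj_symm]
    simp only [Complex.reCLM_apply, Complex.conj_re]
    ring
  have hanti : Antitone f := antitone_of_deriv_nonpos (fun s => (hd s).differentiableAt)
    fun s => by rw [(hd s).deriv]; linarith [hP (NormedSpace.exp ((s : ℂ) • P) x)]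
  have := hanti ht
  have hn : ∀ v : X, (inner ℂ v v).re = ‖v‖ ^ 2 := fun v => inner_self_eq_norm_sq (𝕜 := ℂ) v
  simp only [f, hn] at this
  simpa [NormedSpace.exp_zero] using (sq_le_sq₀ (norm_nonneg _) (norm_nonneg _)).mp this

/-! ### Generators of contraction semigroups are dissipative, with 1 - B onto. -/

section Semigroup

variable {X : Type*} [NormedAddCommGroup X]

theorem tendsto_coe_nhdsGT_zero :
    Tendsto (fun t : ℝ≥0 => (t : ℝ)) (𝓝[>] 0) (𝓝[>] 0) := by
  refine tendsto_nhdsWithin_iff.mpr ⟨?_, ?_⟩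
  · exact (NNReal.continuous_coe.tendsto' 0 0 rfl).mono_left nhdsWithin_le_nhds
  · filter_upwards [self_mem_nhdsWithin] with t ht
    exact NNReal.coe_pos.mpr ht

/-- Difference quotients of contractions are dissipative in the limit. -/
theorem re_inner_nonpos_of_tendsto [InnerProductSpace ℂ X] {T : ℝ≥0 → X →L[ℂ] X}
    (hT : ∀ t, ‖T t‖ ≤ 1) {x y : X}
    (h : Tendsto (fun t : ℝ≥0 => (((t : ℝ) : ℂ)⁻¹) • (T t x - x)) (𝓝[>] 0) (𝓝 y)) :
    (inner ℂ y x).re ≤ 0 := by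
  have h1 := (Complex.continuous_re.tendsto _).comp (h.inner (tendsto_const_nhds (x := x)))
  refine le_of_tendsto h1 (Eventually.of_forall fun t => ?_)
  simp only [Function.comp_apply]
  rw [inner_smul_left, inner_sub_left, ← Complex.ofReal_inv, Complex.conj_ofReal,
    Complex.re_ofReal_mul, Complex.sub_re]
  refine mul_nonpos_of_nonneg_of_nonpos (by positivity) ?_
  have h2 : (inner ℂ (T t x) x).re ≤ ‖x‖ * ‖x‖ :=
    (Complex.re_le_norm _).trans ((norm_inner_le_norm _ _).trans
      (by gcongr; simpa using (T t).le_of_opNorm_le (hT t) x))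
  have h3 : (inner ℂ x x).re = ‖x‖ * ‖x‖ := inner_self_eq_norm_mul_norm (𝕜 := ℂ) x
  linarith

namespace IsC0Semigroup

variable [NormedSpace ℂ X] {T : ℝ≥0 → X →L[ℂ] X}

/-- Contractivity bounds ‖T(s+d)x - T(s)x‖ by ‖T(d)x - x‖, so continuity at 0 propagates to all
times. -/
theorem continuous_apply (h : IsC0Semigroup T) (hT : ∀ t, ‖T t‖ ≤ 1) (x : X) :
    Continuous fun t => T t x := by
  have hle : ∀ (t : ℝ≥0) (v : X), ‖T t v‖ ≤ ‖v‖ := fun t v => by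
    simpa using (T t).le_of_opNorm_le (hT t) v
  have key : ∀ s d : ℝ≥0, ‖T (s + d) x - T s x‖ ≤ ‖T d x - x‖ := fun s d => by
    rw [h.map_add, ContinuousLinearMap.comp_apply, ← map_sub]
    exact hle _ _
  have key2 : ∀ s t : ℝ≥0, ‖T s x - T t x‖ ≤ ‖T (nndist s t) x - x‖ := fun s t => by
    rcases le_total s t with hst | hst
    · have : t = s + nndist s t := by
        rw [NNReal.nndist_eq, tsub_eq_zero_of_le hst, max_eq_right zero_le,
          add_tsub_cancel_of_le hst]
      rw [norm_sub_rev]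
      nth_rewrite 1 [this]
      exact key _ _
    · have : s = t + nndist s t := by
        rw [NNReal.nndist_eq, tsub_eq_zero_of_le hst, max_eq_left zero_le,
          add_tsub_cancel_of_le hst]
      nth_rewrite 1 [this]
      exact key _ _
  rw [continuous_iff_continuousAt]
  intro t
  rw [ContinuousAt, tendsto_iff_norm_sub_tendsto_zero]
  have h1 : Tendsto (fun s : ℝ≥0 => nndist s t) (𝓝 t) (𝓝 0) :=
    (continuous_id.nndist continuous_const).tendsto' t 0 (nndist_self t)
  have h2 := (tendsto_iff_norm_sub_tendsto_zero.mp (h.tendsto_zero x)).comp h1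
  exact squeeze_zero (fun _ => norm_nonneg _) (fun s => key2 s t) h2

/-- `R x = ∫₀^∞ exp (-t) T(t) x dt` satisfies `R x - G R x = x` for the generator `G` of a
contraction semigroup `T`. -/
theorem exists_tendsto_resolvent [CompleteSpace X] (h : IsC0Semigroup T) (hT : ∀ t, ‖T t‖ ≤ 1)
    (x : X) : ∃ r : X,
      Tendsto (fun t : ℝ≥0 => (((t : ℝ) : ℂ)⁻¹) • (T t r - r)) (𝓝[>] 0) (𝓝 (r - x)) := by
  have hle : ∀ (t : ℝ≥0) (v : X), ‖T t v‖ ≤ ‖v‖ := fun t v => by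
    simpa using (T t).le_of_opNorm_le (hT t) v
  -- `toNNReal` extends the integrand continuously to negative times, so that its primitive has a
  -- two-sided derivative at 0.
  let g : ℝ → X := fun t => Real.exp (-t) • T t.toNNReal x
  have hg : Continuous g := by
    have := (h.continuous_apply hT x).comp continuous_real_toNNReal
    exact (Real.continuous_exp.comp continuous_neg).smul this
  have hint : MeasureTheory.IntegrableOn g (Set.Ioi 0) := by
    refine MeasureTheory.Integrable.mono' ((integrableOn_exp_neg_Ioi 0).mul_const ‖x‖)
      hg.aestronglyMeasurable (Eventually.of_forall fun t => ?_)
    rw [norm_smul, Real.norm_eq_abs, abs_of_pos (Real.exp_pos _)]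
    gcongr
    exact hle _ _
  let r : X := ∫ t in Set.Ioi 0, g t
  -- Translation in the integral gives T(s)r = eˢ ∫ₛ^∞ g, whose derivative at 0 is r - g(0) = r - x.
  have hshift : ∀ s : ℝ≥0, T s r = Real.exp s • (r - ∫ t in (0 : ℝ)..s, g t) := fun s => by
    rw [← intervalIntegral.integral_Ioi_sub_Ioi hint s.coe_nonneg, sub_sub_cancel,
      ← (T s).integral_comp_comm hint]
    have hpre : (fun t : ℝ => t + s) ⁻¹' Set.Ioi (s : ℝ) = Set.Ioi 0 := by
      ext t; simp
    rw [← (MeasureTheory.measurePreserving_add_right MeasureTheory.volume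
      (s : ℝ)).setIntegral_preimage_emb (measurableEmbedding_addRight (s : ℝ)) g, hpre,
      ← MeasureTheory.integral_smul]
    refine MeasureTheory.setIntegral_congr_fun measurableSet_Ioi fun t ht => ?_
    have ht' : 0 ≤ t := le_of_lt ht
    have e : (t + s).toNNReal = s + t.toNNReal := by
      rw [Real.toNNReal_add ht' s.coe_nonneg, Real.toNNReal_coe, add_comm]
    simp only [g]
    rw [e, h.map_add, ContinuousLinearMap.comp_apply, smul_smul, ← Real.exp_add]
    have : (s : ℝ) + -(t + s) = -t := by ring
    rw [this]
    exact (T s).map_smul_of_tower _ _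
  refine ⟨r, ?_⟩
  have hd : HasDerivAt (fun s : ℝ => Real.exp s • (r - ∫ t in (0 : ℝ)..s, g t)) (r - x) 0 := by
    have h1 := (hg.integral_hasStrictDerivAt 0 0).hasDerivAt.const_sub r
    have h2 := (Real.hasDerivAt_exp 0).smul h1
    refine h2.congr_deriv ?_
    simp [g, h.map_zero, sub_eq_add_neg, add_comm]
  refine (hd.tendsto_slope_zero_right.comp tendsto_coe_nhdsGT_zero).congr fun s => ?_
  simp only [Function.comp_apply, zero_add, ← hshift]
  rw [← Complex.ofReal_inv, Complex.coe_smul]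
  simp

end IsC0Semigroup

namespace GeneratesContractionSemigroup

variable [InnerProductSpace ℂ X] {B : X →ₗ.[ℂ] X}

theorem isDissipative (h : GeneratesContractionSemigroup B) : B.IsDissipative := by
  obtain ⟨T, -, hT, hgen⟩ := h
  exact fun x y hxy => re_inner_nonpos_of_tendsto hT ((hgen x y).mp hxy)

theorem surjective_one_sub [CompleteSpace X] (h : GeneratesContractionSemigroup B) (z : X) :
    ∃ x y, (x, y) ∈ B.graph ∧ x - y = z := by
  obtain ⟨T, hsg, hT, hgen⟩ := h
  obtain ⟨r, hr⟩ := hsg.exists_tendsto_resolvent hT z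
  exact ⟨r, r - z, (hgen _ _).mpr hr, by abel⟩

end GeneratesContractionSemigroup

end Semigroup

/-! ### Yosida approximation and the Lumer–Phillips theorem. -/

section HilleYosida

variable {X : Type*} [NormedAddCommGroup X] [InnerProductSpace ℂ X]

/-- Bounded dissipative commuting operators approximating `B` pointwise on its domain. -/
theorem LinearPMap.IsDissipative.exists_yosida_approximation [CompleteSpace X] {B : X →ₗ.[ℂ] X}
    (hB : B.IsDissipative) (hdense : Dense (B.domain : Set X))
    (hs : ∀ r : ℝ, 0 < r → ∀ z : X, ∃ x y, (x, y) ∈ B.graph ∧ (r : ℂ) • x - y = z) :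
    ∃ Y : ℕ → X →L[ℂ] X, (∀ m n, Commute (Y m) (Y n)) ∧ (∀ n x, (inner ℂ (Y n x) x).re ≤ 0) ∧
      ∀ x y, (x, y) ∈ B.graph → Tendsto (fun n => Y n x) atTop (𝓝 y) := by
  have hpos : ∀ n : ℕ, (0 : ℝ) < n + 1 := fun n => by positivity
  choose R hmem hbound hinv using fun n : ℕ => hB.exists_resolvent (hpos n) (hs _ (hpos n))
  -- Adding the resolvent identity to its copy with m and n exchanged leaves (m - n)(RₘRₙ - RₙRₘ)z =
  -- 0.
  have hcomm : ∀ m n, Commute (R m) (R n) := fun m n => by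
    rcases eq_or_ne m n with rfl | hmn
    · exact Commute.refl _
    ext z
    have key : ∀ m n : ℕ, (((m : ℝ) + 1 : ℝ) : ℂ) • R m (R n z) -
        (((n : ℝ) + 1 : ℝ) : ℂ) • R m (R n z) + R m z = R n z := fun m n => by
      have := hinv m _ _ (hmem n z)
      rwa [_root_.map_sub, _root_.map_sub, _root_.map_smul, _root_.map_smul, ← sub_add] at this
    have h1 := key m n
    have h2 := key n m
    have h3 : (((m : ℝ) + 1 - (n + 1) : ℝ) : ℂ) • (R m (R n z) - R n (R m z)) = 0 := by
      push_cast at h1 h2 ⊢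
      linear_combination (norm := module) h1 + h2
    have h4 : (((m : ℝ) + 1 - (n + 1) : ℝ) : ℂ) ≠ 0 := by
      rw [Complex.ofReal_ne_zero, add_sub_add_right_eq_sub, sub_ne_zero]
      exact_mod_cast hmn
    exact sub_eq_zero.mp ((smul_eq_zero.mp h3).resolve_left h4)
  let c : ℕ → ℂ := fun n => (((n : ℝ) + 1 : ℝ) : ℂ)
  have hcn : ∀ n, ‖c n‖ = (n : ℝ) + 1 := fun n => by
    rw [Complex.norm_real, Real.norm_eq_abs, abs_of_pos (hpos n)]
  -- Since cR - 1 = BR, this is cBR. The shift c = n + 1 keeps the parameter positive at n = 0.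
  refine ⟨fun n => c n • (c n • R n - 1), fun m n => ?_, fun n x => ?_, fun x y hxy => ?_⟩
  · have h := ((hcomm m n).smul_left (c m)).smul_right (c n)
    exact (((h.sub_left (Commute.one_left _)).sub_right (Commute.one_right _)).smul_left
      (c m)).smul_right (c n)
  · have h1 := hB _ _ (hmem n x)
    set w := R n x
    set y := c n • w - x with hy
    -- With y = Bw and x = cw - y, Re⟨cy, x⟩ = c(c Re⟨y, w⟩ - ‖y‖²), and both terms are nonpositive.
    have hx : x = c n • w - y := by rw [hy]; abel
    change (inner ℂ (c n • y) x).re ≤ 0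
    have h2 : (inner ℂ y y).re = ‖y‖ ^ 2 := inner_self_eq_norm_sq (𝕜 := ℂ) y
    have h3 : (inner ℂ y w).re ≤ 0 := h1
    rw [hx, inner_smul_left, inner_sub_right, inner_smul_right, Complex.conj_ofReal,
      Complex.re_ofReal_mul, Complex.sub_re, Complex.re_ofReal_mul, h2]
    have h4 := hpos n
    nlinarith [sq_nonneg ‖y‖, mul_nonpos_of_nonneg_of_nonpos h4.le h3]
  -- On the domain cBRx = cRy, so it suffices that cₙRₙ → 1 strongly. These are contractions, and on
  -- the dense domain cₙRₙu - u = RₙBu tends to 0.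
  · have hY : ∀ n, (c n • (c n • R n - 1)) x = c n • R n y := fun n => by
      have h1 := hinv n _ _ hxy
      have h2 : c n • R n x - R n y = x := by simpa only [_root_.map_sub, _root_.map_smul] using h1
      change c n • (c n • R n x - x) = _
      nth_rewrite 2 [← h2]
      rw [sub_sub_cancel]
    simp only [hY]
    rw [Metric.tendsto_atTop]
    intro ε hε
    obtain ⟨u, hu, hyu⟩ := Metric.dense_iff.mp hdense y (ε / 3) (by positivity)
    obtain ⟨v, huv⟩ := LinearPMap.mem_domain_iff.mp hyu
    rw [Metric.mem_ball, dist_eq_norm] at hu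
    obtain ⟨N, hN⟩ := exists_nat_gt (‖v‖ / (ε / 3))
    refine ⟨N, fun n hn => ?_⟩
    have hle : ∀ z, ‖c n • R n z‖ ≤ ‖z‖ := fun z => by
      rw [norm_smul, hcn]; exact hbound n z
    have hRv : ‖R n v‖ < ε / 3 := by
      have h1 := hbound n v
      have h2 : ‖v‖ < N * (ε / 3) := (div_lt_iff₀ (by positivity)).mp hN
      have h3 : (N : ℝ) ≤ n := by exact_mod_cast hn
      by_contra hc
      push Not at hc
      nlinarith [mul_le_mul h3 hc (by positivity) (by positivity : (0 : ℝ) ≤ n),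
        norm_nonneg (R n v)]
    have hdec : c n • R n y - y = c n • R n (y - u) + R n v + (u - y) := by
      have h1 := hinv n _ _ huv
      have h2 : c n • R n u - R n v = u := by simpa only [_root_.map_sub, _root_.map_smul] using h1
      rw [_root_.map_sub, smul_sub]
      nth_rewrite 2 [← h2]
      abel
    rw [dist_eq_norm, hdec]
    have h5 := hle (y - u)
    rw [norm_sub_rev y u] at h5
    linarith [norm_add₃_le (a := c n • R n (y - u)) (b := R n v) (c := u - y)]

/-- The Hille–Yosida (Lumer–Phillips) theorem in Hilbert spaces. -/
theorem LinearPMap.IsDissipative.generatesContractionSemigroup [CompleteSpace X]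
    {B : X →ₗ.[ℂ] X} (hB : B.IsDissipative) (hdense : Dense (B.domain : Set X))
    (hs : ∀ r : ℝ, 0 < r → ∀ z : X, ∃ x y, (x, y) ∈ B.graph ∧ (r : ℂ) • x - y = z) :
    GeneratesContractionSemigroup B := by
  obtain ⟨Y, hcomm, hdiss, hlim⟩ := hB.exists_yosida_approximation hdense hs
  let E : ℕ → ℝ≥0 → X →L[ℂ] X := fun n t => NormedSpace.exp (((t : ℝ) : ℂ) • Y n)
  have hEle : ∀ n t x, ‖E n t x‖ ≤ ‖x‖ := fun n t x =>
    norm_exp_smul_apply_le_of_dissipative (hdiss n) t.coe_nonneg x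
  have hEsub : ∀ m n t x, ‖E m t x - E n t x‖ ≤ t * ‖Y m x - Y n x‖ := fun m n t x =>
    norm_exp_smul_sub_exp_smul_le (hcomm m n)
      (fun s hs => norm_exp_smul_apply_le_of_dissipative (hdiss m) hs)
      (fun s hs => norm_exp_smul_apply_le_of_dissipative (hdiss n) hs) t.coe_nonneg x
  have hEcauchy : ∀ t x, CauchySeq fun n => E n t x := fun t x => by
    rw [Metric.cauchySeq_iff]
    intro ε hε
    obtain ⟨u, hu, hud⟩ := Metric.dense_iff.mp hdense x (ε / 3) (by positivity)
    obtain ⟨v, huv⟩ := LinearPMap.mem_domain_iff.mp hud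
    rw [Metric.mem_ball, dist_eq_norm, norm_sub_rev] at hu
    -- Dividing by t + 1 instead of t covers t = 0.
    obtain ⟨N, hN⟩ := Metric.cauchySeq_iff.mp (hlim u v huv).cauchySeq (ε / 3 / (t + 1))
      (by positivity)
    refine ⟨N, fun m hm n hn => ?_⟩
    have h1 := hN m hm n hn
    rw [dist_eq_norm, lt_div_iff₀ (by positivity)] at h1
    have h2 := hEsub m n t u
    have hdec : E m t x - E n t x = E m t (x - u) + (E m t u - E n t u) + -E n t (x - u) := by
      simp only [_root_.map_sub]; abel
    rw [dist_eq_norm, hdec]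
    have h3 := hEle m t (x - u)
    have h4 := hEle n t (x - u)
    have h5 := norm_add₃_le (a := E m t (x - u)) (b := E m t u - E n t u) (c := -E n t (x - u))
    rw [norm_neg] at h5
    nlinarith [norm_nonneg (Y m u - Y n u)]
  choose S hS using fun t x => cauchySeq_tendsto_of_complete (hEcauchy t x)
  let T : ℝ≥0 → X →L[ℂ] X := fun t =>
    continuousLinearMapOfTendsto (fun n => E n t) (tendsto_pi_nhds.mpr (hS t))
  have hT : ∀ t x, Tendsto (fun n => E n t x) atTop (𝓝 (T t x)) := hS
  have hTle : ∀ t x, ‖T t x‖ ≤ ‖x‖ := fun t x =>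
    le_of_tendsto (hT t x).norm (Eventually.of_forall fun n => hEle n t x)
  have hTnorm : ∀ t, ‖T t‖ ≤ 1 := fun t =>
    (T t).opNorm_le_bound zero_le_one fun x => by simpa using hTle t x
  -- Letting m → ∞ in `hEsub` gives an error linear in t, so after division by t the derivative of T
  -- at 0 can be read off from that of a single Eₙ.
  have hTE : ∀ n t x y, (x, y) ∈ B.graph → ‖T t x - E n t x‖ ≤ t * ‖y - Y n x‖ :=
    fun n t x y hxy => le_of_tendsto_of_tendsto' ((hT t x).sub_const _).norm
      (((hlim x y hxy).sub_const _).norm.const_mul _) fun m => hEsub m n t x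
  have hTzero : ∀ x, T 0 x = x := fun x =>
    tendsto_nhds_unique (hT 0 x) (by simp [E, NormedSpace.exp_zero])
  have hTadd : ∀ s t x, T (s + t) x = T s (T t x) := fun s t x => by
    refine tendsto_nhds_unique (hT (s + t) x) ?_
    have h1 : ∀ n, E n (s + t) x = E n s (E n t x - T t x) + E n s (T t x) := fun n => by
      have := congrArg (fun L : X →L[ℂ] X => L x) (exp_ofReal_add_smul (Y n) s t)
      rw [_root_.map_sub, sub_add_cancel]
      simpa only [E, NNReal.coe_add, mul_apply_eq_comp] using this
    simp only [h1]
    have h2 : Tendsto (fun n => E n s (E n t x - T t x)) atTop (𝓝 0) :=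
      squeeze_zero_norm (fun n => hEle n s _) (tendsto_iff_norm_sub_tendsto_zero.mp (hT t x))
    simpa using h2.add (hT s (T t x))
  have hEderiv : ∀ n x, Tendsto (fun t : ℝ≥0 => (((t : ℝ) : ℂ)⁻¹) • (E n t x - x)) (𝓝[>] 0)
      (𝓝 (Y n x)) := fun n x => by
    have h1 := hasDerivAt_exp_ofReal_smul_apply (Y n) x 0
    simp only [Complex.ofReal_zero, zero_smul, NormedSpace.exp_zero,
      one_apply_eq_self] at h1
    refine (h1.tendsto_slope_zero_right.comp tendsto_coe_nhdsGT_zero).congr fun s => ?_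
    simp only [Function.comp_apply, zero_add]
    rw [← Complex.ofReal_inv, Complex.coe_smul (s : ℝ)⁻¹]
    simp only [E, Complex.ofReal_zero, zero_smul, NormedSpace.exp_zero, one_apply_eq_self]
  have hEcont : ∀ n x, Tendsto (fun t : ℝ≥0 => E n t x) (𝓝 0) (𝓝 x) := fun n x => by
    have h1 := (hasDerivAt_exp_ofReal_smul_apply (Y n) x 0).continuousAt
    have h2 := h1.tendsto.comp (NNReal.continuous_coe.tendsto' 0 0 rfl)
    simpa [E, NormedSpace.exp_zero, Function.comp_def] using h2
  have hderiv : ∀ x y, (x, y) ∈ B.graph →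
      Tendsto (fun t : ℝ≥0 => (((t : ℝ) : ℂ)⁻¹) • (T t x - x)) (𝓝[>] 0) (𝓝 y) := by
    intro x y hxy
    rw [Metric.tendsto_nhds]
    intro ε hε
    obtain ⟨n, hn⟩ := (Metric.tendsto_nhds.mp (hlim x y hxy) (ε / 3) (by positivity)).exists
    filter_upwards [Metric.tendsto_nhds.mp (hEderiv n x) (ε / 3) (by positivity),
      self_mem_nhdsWithin] with t ht ht0
    have ht0' : (0 : ℝ) < t := NNReal.coe_pos.mpr ht0
    have h1 : ‖(((t : ℝ) : ℂ)⁻¹) • (T t x - E n t x)‖ ≤ ‖y - Y n x‖ := by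
      rw [norm_smul, norm_inv, Complex.norm_real, Real.norm_eq_abs, abs_of_pos ht0',
        inv_mul_le_iff₀ ht0']
      exact hTE n t x y hxy
    rw [dist_eq_norm] at hn ht ⊢
    have hdec : (((t : ℝ) : ℂ)⁻¹) • (T t x - x) - y = (((t : ℝ) : ℂ)⁻¹) • (T t x - E n t x) +
        ((((t : ℝ) : ℂ)⁻¹) • (E n t x - x) - Y n x) + (Y n x - y) := by
      simp only [smul_sub]; abel
    rw [hdec]
    rw [norm_sub_rev] at h1
    linarith [norm_add₃_le (a := (((t : ℝ) : ℂ)⁻¹) • (T t x - E n t x))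
      (b := (((t : ℝ) : ℂ)⁻¹) • (E n t x - x) - Y n x) (c := Y n x - y),
      norm_sub_rev y (Y n x), norm_sub_rev (T t x) (E n t x)]
  have hcont : ∀ x, Tendsto (fun t : ℝ≥0 => T t x) (𝓝 0) (𝓝 x) := by
    intro x
    rw [Metric.tendsto_nhds]
    intro ε hε
    obtain ⟨u, hu, hud⟩ := Metric.dense_iff.mp hdense x (ε / 4) (by positivity)
    obtain ⟨v, huv⟩ := LinearPMap.mem_domain_iff.mp hud
    rw [Metric.mem_ball, dist_eq_norm] at hu
    have h1 : Tendsto (fun t : ℝ≥0 => (t : ℝ) * ‖v - Y 0 u‖) (𝓝 0) (𝓝 0) :=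
      (NNReal.continuous_coe.mul continuous_const).tendsto' _ _ (by simp)
    filter_upwards [Metric.tendsto_nhds.mp (hEcont 0 u) (ε / 4) (by positivity),
      h1.eventually_lt_const (by positivity : (0 : ℝ) < ε / 4)] with t ht1 ht2
    rw [dist_eq_norm] at ht1 ⊢
    have h2 := hTE 0 t u v huv
    have h3 := hTle t (x - u)
    rw [norm_sub_rev x u] at h3
    have hdec : T t x - x = (T t (x - u) + (T t u - E 0 t u) + (E 0 t u - u)) + (u - x) := by
      rw [_root_.map_sub]; abel
    rw [hdec]
    linarith [norm_add_le (T t (x - u) + (T t u - E 0 t u) + (E 0 t u - u)) (u - x),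
      norm_add₃_le (a := T t (x - u)) (b := T t u - E 0 t u) (c := E 0 t u - u)]
  refine ⟨T, ⟨ContinuousLinearMap.ext hTzero, fun s t => ContinuousLinearMap.ext (hTadd s t),
    hcont⟩, hTnorm, fun x y => ⟨hderiv x y, fun hxy => ?_⟩⟩
  -- The generator of T is no larger than B: choose (x', y') in the graph of B with x' - y' = x - y.
  -- Dissipativity of the limit quotients at x - x' = y - y' then gives ‖x - x'‖² ≤ 0.
  obtain ⟨x', y', h', he⟩ := hs 1 one_pos (x - y)
  rw [Complex.ofReal_one, one_smul] at he
  have hw : x - x' = y - y' := by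
    rw [sub_eq_sub_iff_add_eq_add, ← sub_eq_sub_iff_add_eq_add.mp he]; abel
  have h1 : Tendsto (fun t : ℝ≥0 => (((t : ℝ) : ℂ)⁻¹) • (T t (x - x') - (x - x'))) (𝓝[>] 0)
      (𝓝 (y - y')) := by
    refine (hxy.sub (hderiv x' y' h')).congr fun t => ?_
    rw [_root_.map_sub, ← smul_sub]; congr 1; abel
  have h2 := re_inner_nonpos_of_tendsto hTnorm h1
  have h3 : (inner ℂ (x - x') (x - x')).re = ‖x - x'‖ ^ 2 :=
    inner_self_eq_norm_sq (𝕜 := ℂ) (x - x')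
  rw [← hw, h3] at h2
  have h4 : x - x' = 0 := by
    rw [← norm_eq_zero]
    exact pow_eq_zero_iff two_ne_zero |>.mp (le_antisymm h2 (sq_nonneg _))
  rw [sub_eq_zero.mp h4, sub_eq_zero.mp (hw.symm.trans h4)]
  exact h'

end HilleYosida

/-! ### Boundary triplets and contractive boundary conditions. -/

section BoundaryTriplet

variable {X H : Type*} [NormedAddCommGroup X] [InnerProductSpace ℂ X]
  [NormedAddCommGroup H] [InnerProductSpace ℂ H]

theorem norm_add_sq_eq_norm_sub_sq_add (u v : H) :
    ‖u + v‖ ^ 2 = ‖u - v‖ ^ 2 + 4 * (inner ℂ u v).re := by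
  have h1 := norm_add_sq (𝕜 := ℂ) u v
  have h2 := norm_sub_sq (𝕜 := ℂ) u v
  simp only [RCLike.re_eq_complex_re] at h1 h2
  linarith

/-- A contraction from the range of `e` to a Hilbert space extends to the whole space. -/
theorem exists_contraction_comp_eq [CompleteSpace H] {D : Type*} [AddCommGroup D] [Module ℂ D]
    (e f : D →ₗ[ℂ] H) (h : ∀ x, ‖f x‖ ≤ ‖e x‖) :
    ∃ K : H →L[ℂ] H, ‖K‖ ≤ 1 ∧ ∀ x, K (e x) = f x := by
  let S : Submodule ℂ H := e.range.topologicalClosure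
  have hmem : ∀ x, e x ∈ S := fun x =>
    Submodule.le_topologicalClosure _ (LinearMap.mem_range_self e x)
  let e' : D →ₗ[ℂ] S := e.codRestrict S hmem
  have hdense : DenseRange e' := by
    rw [DenseRange, Subtype.dense_iff]
    intro x hx
    have : Subtype.val '' Set.range e' = (e.range : Set H) := by
      ext y
      simp [e']
    exact this.symm ▸ hx
  have hS : IsClosed (S : Set H) := Submodule.isClosed_topologicalClosure _
  have : CompleteSpace S := hS.completeSpace_coe
  have hb : ∀ x, ‖f x‖ ≤ 1 * ‖e' x‖ := fun x => by rw [one_mul]; exact h x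
  -- Extend by continuity to the closure of the range, and by zero on its orthogonal complement.
  refine ⟨(f.extendOfNorm e').comp S.orthogonalProjectionOnto, ?_, fun x => ?_⟩
  · refine (ContinuousLinearMap.opNorm_comp_le _ _).trans ?_
    exact mul_le_one₀ (LinearMap.opNorm_extendOfNorm_le hdense zero_le_one hb) (norm_nonneg _)
      S.orthogonalProjectionOnto_norm_le
  · have h1 : S.orthogonalProjectionOnto (e x) = e' x :=
      S.orthogonalProjectionOnto_mem_subspace_eq_self (e' x)
    rw [ContinuousLinearMap.comp_apply, h1, LinearMap.extendOfNorm_eq hdense ⟨1, hb⟩]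

variable [CompleteSpace X] {A B : X →ₗ.[ℂ] X} {Γ₁ Γ₂ : A†.domain →ₗ[ℂ] H}

/-- A dissipative extension of a skew-symmetric operator `A` is a restriction of `-A†`. -/
theorem IsSkewSymmetric.le_neg_adjoint (hA : IsSkewSymmetric A) (hAB : A ≤ B)
    (hB : B.IsDissipative) : B ≤ -A† := by
  have hformal : A.IsFormalAdjoint (-B) := by
    rintro ⟨x, hx⟩ ⟨y, hy⟩
    have hAx : B ⟨x, hAB.1 hx⟩ = A ⟨x, hx⟩ := (hAB.2 rfl).symm
    have hre : (inner ℂ (A ⟨x, hx⟩) x).re = 0 := by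
      have h1 : A ⟨x, hx⟩ = -A† ⟨x, hA.2.1 hx⟩ := hA.2.2 rfl
      have h2 := A.adjoint_isFormalAdjoint hA.1 ⟨x, hA.2.1 hx⟩ ⟨x, hx⟩
      have h3 : (inner ℂ (A ⟨x, hx⟩) x) = -inner ℂ x (A ⟨x, hx⟩) := by
        rw [← h2]; nth_rewrite 1 [h1]; rw [inner_neg_left]
      have h4 := congrArg Complex.re h3
      rw [← inner_conj_symm, Complex.conj_re, Complex.neg_re] at h4
      have h5 : (inner ℂ (A ⟨x, hx⟩) x).re = (inner ℂ x (A ⟨x, hx⟩)).re := by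
        rw [← inner_conj_symm, Complex.conj_re]
      linarith
    set a := A ⟨x, hx⟩
    set b := B ⟨y, hy⟩
    set z : ℂ := inner ℂ b x + inner ℂ y a
    have hga : (x, a) ∈ B.graph := hAx ▸ B.mem_graph ⟨x, hAB.1 hx⟩
    have hgb : (y, b) ∈ B.graph := B.mem_graph ⟨y, hy⟩
    -- Move y by the multiple t z̄ of x. As Re⟨Ax, x⟩ = 0, the quadratic term drops out, and an
    -- affine function of t bounded above has slope ‖z‖² = 0.
    have hle : ∀ t : ℝ, (inner ℂ b y).re + t * ‖z‖ ^ 2 ≤ 0 := fun t => by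
      have h1 := hB _ _ (B.graph.add_mem hgb
        (B.graph.smul_mem ((t : ℂ) * (starRingEnd ℂ) z) hga))
      simp only [Prod.smul_mk, inner_add_left, inner_add_right, inner_smul_left,
        inner_smul_right, map_mul, Complex.conj_conj, Complex.conj_ofReal, Complex.add_re] at h1
      have h2 : ((t : ℂ) * z * inner ℂ a y).re = ((t : ℂ) * (starRingEnd ℂ) z * inner ℂ y a).re := by
        rw [← Complex.conj_re, map_mul, map_mul, inner_conj_symm, Complex.conj_ofReal]
      have h3 : ((t : ℂ) * (starRingEnd ℂ) z * inner ℂ b x).re +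
          ((t : ℂ) * (starRingEnd ℂ) z * inner ℂ y a).re = t * ‖z‖ ^ 2 := by
        rw [← Complex.add_re, ← mul_add, mul_assoc, Complex.re_ofReal_mul, mul_comm _ z,
          Complex.mul_conj, Complex.ofReal_re, Complex.normSq_eq_norm_sq]
      have h4 : ((t : ℂ) * (starRingEnd ℂ) z * ((t : ℂ) * z * inner ℂ a x)).re = 0 := by
        have : (t : ℂ) * (starRingEnd ℂ) z * ((t : ℂ) * z * inner ℂ a x) =
            ((t * t * ‖z‖ ^ 2 : ℝ) : ℂ) * inner ℂ a x := by
          have h5 := Complex.mul_conj z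
          rw [Complex.normSq_eq_norm_sq] at h5
          push_cast at h5 ⊢
          rw [← h5]; ring
        rw [this, Complex.re_ofReal_mul, hre, mul_zero]
      have h4' : ((t : ℂ) * z * ((t : ℂ) * (starRingEnd ℂ) z * inner ℂ a x)).re = 0 := by
        rw [← h4]; congr 1; ring
      simp only [mul_assoc, mul_add, Complex.add_re] at h1 h2 h3 h4 h4'
      linarith
    have hz : z = 0 := by
      by_contra hne
      have hp : 0 < ‖z‖ ^ 2 := by positivity
      have := hle ((1 - (inner ℂ b y).re) / ‖z‖ ^ 2)
      rw [div_mul_cancel₀ _ hp.ne'] at this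
      linarith
    change inner ℂ a y = inner ℂ x (-b)
    rw [inner_neg_right, ← inner_conj_symm, ← inner_conj_symm x b, ← map_neg]
    congr 1
    linear_combination hz
  have h := hformal.le_adjoint hA.1
  refine ⟨h.1, fun x y hxy => ?_⟩
  have := h.2 (x := x) (y := y) hxy
  rw [LinearPMap.neg_apply] at this ⊢
  rw [← this, neg_neg]

namespace IsBoundaryTriplet

theorem re_inner_adjoint_apply (hΓ : IsBoundaryTriplet A Γ₁ Γ₂) (x : A†.domain) :
    (inner ℂ (A† x) (x : X)).re = (inner ℂ (Γ₁ x) (Γ₂ x)).re := by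
  have h := congrArg Complex.re (hΓ.green x x)
  rw [Complex.add_re, Complex.add_re, ← inner_conj_symm (x : X), ← inner_conj_symm (Γ₂ x),
    Complex.conj_re, Complex.conj_re] at h
  linarith

/-- Every pair `(Γ₁ x + Γ₂ x, Γ₁ x - Γ₂ x)` is attained. -/
theorem exists_add_sub_eq (hΓ : IsBoundaryTriplet A Γ₁ Γ₂) (u v : H) :
    ∃ x, Γ₁ x + Γ₂ x = u ∧ Γ₁ x - Γ₂ x = v := by
  obtain ⟨x, h1, h2⟩ := hΓ.surjective ((2⁻¹ : ℂ) • (u + v)) ((2⁻¹ : ℂ) • (u - v))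
  refine ⟨x, ?_, ?_⟩ <;> rw [h1, h2] <;> module

end IsBoundaryTriplet

variable (Γ₁ Γ₂) in
/-- The submodule of boundary values `K (Γ₁ x + Γ₂ x) = Γ₁ x - Γ₂ x`. -/
noncomputable def boundaryConditionDomain (K : H →L[ℂ] H) : Submodule ℂ X :=
  (LinearMap.ker ((K : H →ₗ[ℂ] H) ∘ₗ (Γ₁ + Γ₂) - (Γ₁ - Γ₂))).map A†.domain.subtype

theorem mem_boundaryConditionDomain {K : H →L[ℂ] H} {x : X} :
    x ∈ boundaryConditionDomain Γ₁ Γ₂ K ↔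
      ∃ hx : x ∈ A†.domain, K (Γ₁ ⟨x, hx⟩ + Γ₂ ⟨x, hx⟩) = Γ₁ ⟨x, hx⟩ - Γ₂ ⟨x, hx⟩ := by
  simp [boundaryConditionDomain, sub_eq_zero]

variable (Γ₁ Γ₂) in
/-- The restriction of `-A†` to the boundary condition `K (Γ₁ x + Γ₂ x) = Γ₁ x - Γ₂ x`. -/
noncomputable def boundaryConditionOperator (K : H →L[ℂ] H) : X →ₗ.[ℂ] X :=
  (-A†).domRestrict (boundaryConditionDomain Γ₁ Γ₂ K)

theorem mem_graph_boundaryConditionOperator {K : H →L[ℂ] H} {x y : X} :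
    (x, y) ∈ (boundaryConditionOperator Γ₁ Γ₂ K).graph ↔
      ∃ hx : x ∈ A†.domain, K (Γ₁ ⟨x, hx⟩ + Γ₂ ⟨x, hx⟩) = Γ₁ ⟨x, hx⟩ - Γ₂ ⟨x, hx⟩ ∧
        -A† ⟨x, hx⟩ = y := by
  rw [LinearPMap.mem_graph_iff]
  constructor
  · rintro ⟨⟨w, hw⟩, rfl, rfl⟩
    obtain ⟨hx, h⟩ := mem_boundaryConditionDomain.mp hw.1
    refine ⟨hx, h, ?_⟩
    exact (LinearPMap.domRestrict_apply (f := -A†) (y := ⟨w, hx⟩) rfl).symm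
  · rintro ⟨hx, h, rfl⟩
    refine ⟨⟨x, mem_boundaryConditionDomain.mpr ⟨hx, h⟩, hx⟩, rfl, ?_⟩
    exact LinearPMap.domRestrict_apply (f := -A†) (y := ⟨x, hx⟩) rfl

/-- The boundary condition in the form `(K - 1) Γ₁ x + (K + 1) Γ₂ x = 0`. -/
theorem eq_boundaryConditionOperator_iff {K : H →L[ℂ] H} :
    B = boundaryConditionOperator Γ₁ Γ₂ K ↔
      (B.domain : Set X) = {x : X | ∃ hx : x ∈ A†.domain,
        (K - 1) (Γ₁ ⟨x, hx⟩) + (K + 1) (Γ₂ ⟨x, hx⟩) = 0} ∧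
      B = (-A†).domRestrict B.domain := by
  have hset : {x : X | ∃ hx : x ∈ A†.domain,
      (K - 1) (Γ₁ ⟨x, hx⟩) + (K + 1) (Γ₂ ⟨x, hx⟩) = 0} =
      (boundaryConditionDomain Γ₁ Γ₂ K : Set X) := by
    ext x
    rw [SetLike.mem_coe, mem_boundaryConditionDomain]
    refine exists_congr fun hx => ?_
    rw [map_add, ← sub_eq_zero (a := K _ + K _)]
    refine Eq.congr ?_ rfl
    simp only [sub_apply, add_apply,
      one_apply_eq_self]
    abel
  have hdom : (boundaryConditionOperator Γ₁ Γ₂ K).domain = boundaryConditionDomain Γ₁ Γ₂ K :=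
    inf_eq_left.mpr fun x hx => (mem_boundaryConditionDomain.mp hx).1
  rw [hset, SetLike.coe_set_eq]
  constructor
  · rintro rfl
    refine ⟨hdom, ?_⟩
    rw [hdom]; rfl
  · rintro ⟨h1, h2⟩
    rw [h2, h1]; rfl

namespace IsBoundaryTriplet

variable {K : H →L[ℂ] H}

theorem boundaryConditionOperator_isDissipative (hΓ : IsBoundaryTriplet A Γ₁ Γ₂)
    (hK : ‖K‖ ≤ 1) : (boundaryConditionOperator Γ₁ Γ₂ K).IsDissipative := by
  intro x y hxy
  obtain ⟨hx, h, rfl⟩ := mem_graph_boundaryConditionOperator.mp hxy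
  rw [inner_neg_left, Complex.neg_re, neg_nonpos, hΓ.re_inner_adjoint_apply ⟨x, hx⟩]
  have h1 := norm_add_sq_eq_norm_sub_sq_add (Γ₁ ⟨x, hx⟩) (Γ₂ ⟨x, hx⟩)
  have h2 := K.le_of_opNorm_le hK (Γ₁ ⟨x, hx⟩ + Γ₂ ⟨x, hx⟩)
  rw [h, one_mul] at h2
  nlinarith [norm_nonneg (Γ₁ ⟨x, hx⟩ - Γ₂ ⟨x, hx⟩)]

/-- For every u some x has Γ₁x + Γ₂x = u and Γ₁x - Γ₂x = Ku; it lies in the domain, which therefore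
determines Ku. -/
theorem boundaryConditionOperator_injective (hΓ : IsBoundaryTriplet A Γ₁ Γ₂) :
    Function.Injective (boundaryConditionOperator Γ₁ Γ₂) := by
  intro K K' h
  ext u
  obtain ⟨x, h1, h2⟩ := hΓ.exists_add_sub_eq u (K u)
  have hm : ((x : X), -A† x) ∈ (boundaryConditionOperator Γ₁ Γ₂ K).graph :=
    mem_graph_boundaryConditionOperator.mpr ⟨x.2, by rw [Subtype.coe_eta, h1, h2], rfl⟩
  rw [h] at hm
  obtain ⟨_, h3, -⟩ := mem_graph_boundaryConditionOperator.mp hm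
  rw [Subtype.coe_eta, h1, h2] at h3
  exact h3.symm

/-- Every dissipative restriction of `-A†` satisfies a contractive boundary condition. -/
theorem exists_le_boundaryConditionOperator [CompleteSpace H] (hΓ : IsBoundaryTriplet A Γ₁ Γ₂)
    (hle : B ≤ -A†) (hB : B.IsDissipative) :
    ∃ K : H →L[ℂ] H, ‖K‖ ≤ 1 ∧ B ≤ boundaryConditionOperator Γ₁ Γ₂ K := by
  let ι : B.domain →ₗ[ℂ] A†.domain := Submodule.inclusion hle.1
  have hval : ∀ x : B.domain, -A† (ι x) = B x := fun x => (hle.2 rfl).symm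
  obtain ⟨K, hK, h⟩ := exists_contraction_comp_eq ((Γ₁ + Γ₂) ∘ₗ ι) ((Γ₁ - Γ₂) ∘ₗ ι) fun x => by
    have h1 := hB _ _ (B.mem_graph x)
    rw [← hval, inner_neg_left, Complex.neg_re, neg_nonpos] at h1
    have h2 := hΓ.re_inner_adjoint_apply (ι x)
    have h3 := norm_add_sq_eq_norm_sub_sq_add (Γ₁ (ι x)) (Γ₂ (ι x))
    have h4 : 0 ≤ (inner ℂ (A† (ι x)) (ι x : X)).re := h1
    exact abs_le_of_sq_le_sq' (by
      simp only [LinearMap.comp_apply, LinearMap.add_apply, LinearMap.sub_apply]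
      linarith) (norm_nonneg _) |>.2
  refine ⟨K, hK, LinearPMap.le_of_le_graph ?_⟩
  rintro ⟨x, y⟩ hxy
  obtain ⟨w, rfl, rfl⟩ := (LinearPMap.mem_graph_iff _).mp hxy
  exact mem_graph_boundaryConditionOperator.mpr ⟨hle.1 w.2, h w, hval w⟩

/-- The maps Γ₁, Γ₂ are not assumed continuous, so the boundary condition cannot simply be passed to
the limit. The limit w lies in D(A†) because A† is closed. Compare it with a domain element z having
the same Γ₁ + Γ₂: dissipativity survives in the limit, and at w - z it forces Γ₁ - Γ₂ to vanish too.
-/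
theorem isClosed_graph_boundaryConditionOperator (hΓ : IsBoundaryTriplet A Γ₁ Γ₂)
    (hA : Dense (A.domain : Set X)) (hK : ‖K‖ ≤ 1) :
    IsClosed ((boundaryConditionOperator Γ₁ Γ₂ K).graph : Set (X × X)) := by
  rw [← isSeqClosed_iff_isClosed]
  rintro p ⟨x, y⟩ hp hlim
  have hx := (continuous_fst.tendsto _).comp hlim
  have hy := (continuous_snd.tendsto _).comp hlim
  have hadj : (x, -y) ∈ A†.graph := by
    refine (LinearPMap.adjoint_isClosed hA).mem_of_tendsto (hx.prodMk_nhds hy.neg)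
      (Eventually.of_forall fun n => ?_)
    obtain ⟨h1, -, h2⟩ := mem_graph_boundaryConditionOperator.mp (hp n)
    simp only [Function.comp_apply, ← h2, neg_neg]
    exact A†.mem_graph ⟨_, h1⟩
  obtain ⟨w, rfl, hw⟩ := (LinearPMap.mem_graph_iff _).mp hadj
  simp only at hw
  obtain ⟨z, hz1, hz2⟩ := hΓ.exists_add_sub_eq (Γ₁ w + Γ₂ w) (K (Γ₁ w + Γ₂ w))
  have hzmem : ((z : X), -A† z) ∈ (boundaryConditionOperator Γ₁ Γ₂ K).graph :=
    mem_graph_boundaryConditionOperator.mpr ⟨z.2, by rw [Subtype.coe_eta, hz1, hz2], rfl⟩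
  have hdiss : (inner ℂ (y - -A† z) ((w : X) - z)).re ≤ 0 :=
    le_of_tendsto ((Complex.continuous_re.tendsto _).comp
      ((hy.sub_const (-A† z)).inner (hx.sub_const (z : X)))) (Eventually.of_forall fun n =>
        hΓ.boundaryConditionOperator_isDissipative hK _ _ (Submodule.sub_mem _ (hp n) hzmem))
  have hval : y - -A† z = -A† (w - z) := by
    rw [LinearPMap.map_sub, hw]; abel
  have h1 := hΓ.re_inner_adjoint_apply (w - z)
  rw [hval, inner_neg_left, Complex.neg_re, neg_nonpos, ← Submodule.coe_sub, h1] at hdiss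
  have h2 := norm_add_sq_eq_norm_sub_sq_add (Γ₁ (w - z)) (Γ₂ (w - z))
  have h3 : Γ₁ (w - z) + Γ₂ (w - z) = 0 := by
    rw [map_sub, map_sub, ← sub_eq_zero.mpr hz1.symm]; abel
  have h4 : Γ₁ (w - z) - Γ₂ (w - z) = 0 := by
    rw [h3, norm_zero] at h2
    rw [← norm_eq_zero]
    exact pow_eq_zero_iff two_ne_zero |>.mp
      (le_antisymm (by nlinarith) (sq_nonneg ‖Γ₁ (w - z) - Γ₂ (w - z)‖))
  refine mem_graph_boundaryConditionOperator.mpr ⟨w.2, ?_, by rw [Subtype.coe_eta, hw, neg_neg]⟩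
  rw [Subtype.coe_eta, ← hz2, ← sub_eq_zero, ← neg_eq_zero, ← h4, map_sub, map_sub]
  abel

/-- The range is closed, since the graph is complete and r - B is bounded below in graph norm. A
vector v orthogonal to it satisfies A†v = rv, because the operator extends A; the boundary condition
and Green's identity then exclude v ≠ 0. -/
theorem surjective_smul_sub_boundaryConditionOperator (hΓ : IsBoundaryTriplet A Γ₁ Γ₂)
    (hA : IsSkewSymmetric A) (hle : A ≤ boundaryConditionOperator Γ₁ Γ₂ K) (hK : ‖K‖ ≤ 1)
    {r : ℝ} (hr : 0 < r) (z : X) :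
    ∃ x y, (x, y) ∈ (boundaryConditionOperator Γ₁ Γ₂ K).graph ∧ (r : ℂ) • x - y = z := by
  set G := (boundaryConditionOperator Γ₁ Γ₂ K).graph
  have hG : IsClosed (G : Set (X × X)) := hΓ.isClosed_graph_boundaryConditionOperator hA.1 hK
  have : CompleteSpace G := hG.completeSpace_coe
  let L : G →L[ℂ] X := ((r : ℂ) • ContinuousLinearMap.fst ℂ X X -
    ContinuousLinearMap.snd ℂ X X).comp G.subtypeL
  -- The constant adds ‖x‖ ≤ r⁻¹‖rx - y‖ and ‖y‖ ≤ r‖x‖ + ‖rx - y‖ ≤ 2‖rx - y‖.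
  have hanti : AntilipschitzWith (Real.toNNReal (r⁻¹ + 2)) L := by
    refine AddMonoidHomClass.antilipschitz_of_bound L fun p => ?_
    obtain ⟨⟨x, y⟩, hp⟩ := p
    rw [Real.coe_toNNReal _ (by positivity)]
    have h1 := (hΓ.boundaryConditionOperator_isDissipative hK).mul_norm_le r hp
    change max ‖x‖ ‖y‖ ≤ (r⁻¹ + 2) * ‖(r : ℂ) • x - y‖
    have h2 : ‖x‖ ≤ r⁻¹ * ‖(r : ℂ) • x - y‖ := by rwa [inv_mul_eq_div, le_div_iff₀' hr]
    have h3 : ‖y‖ ≤ r * ‖x‖ + ‖(r : ℂ) • x - y‖ := by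
      have h4 : y = (r : ℂ) • x - ((r : ℂ) • x - y) := by abel
      have h5 := norm_sub_le ((r : ℂ) • x) ((r : ℂ) • x - y)
      rwa [← h4, norm_smul, Complex.norm_real, Real.norm_eq_abs, abs_of_pos hr] at h5
    rw [add_mul]
    have h6 : 0 ≤ r⁻¹ * ‖(r : ℂ) • x - y‖ := by positivity
    exact max_le (by linarith [norm_nonneg ((r : ℂ) • x - y)]) (by linarith)
  have hclosed : IsClosed (L.range : Set X) :=
    hanti.isClosed_range L.uniformContinuous
  have : CompleteSpace L.range := hclosed.completeSpace_coe
  have htop : L.range = ⊤ := by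
    rw [← Submodule.orthogonal_eq_bot_iff, Submodule.eq_bot_iff]
    intro v hv
    have horth : ∀ x y, (x, y) ∈ G → inner ℂ v ((r : ℂ) • x - y) = 0 := fun x y hxy =>
      (Submodule.mem_orthogonal' _ _).mp hv _ ⟨⟨(x, y), hxy⟩, rfl⟩
    have hAv : ∀ x : A.domain, inner ℂ ((r : ℂ) • v) (x : X) = inner ℂ v (A x) := fun x => by
      have h1 := horth _ _ (LinearPMap.le_graph_of_le hle (A.mem_graph x))
      rw [inner_sub_right, inner_smul_right, sub_eq_zero] at h1
      rw [inner_smul_left, Complex.conj_ofReal, h1]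
    have hvd : v ∈ A†.domain := LinearPMap.mem_adjoint_domain_of_exists v ⟨_, hAv⟩
    have hAdj : A† ⟨v, hvd⟩ = (r : ℂ) • v := LinearPMap.adjoint_apply_eq hA.1 ⟨v, hvd⟩ hAv
    set g₁ := Γ₁ ⟨v, hvd⟩ with hg₁
    set g₂ := Γ₂ ⟨v, hvd⟩ with hg₂
    -- Testing orthogonality on the domain element whose Γ₁ + Γ₂ agrees with that of v yields ‖g₁ +
    -- g₂‖ ≤ ‖g₁ - g₂‖, while Green's identity at v gives ‖g₁ + g₂‖² - ‖g₁ - g₂‖² = 4r‖v‖².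
    obtain ⟨x, hx1, hx2⟩ := hΓ.exists_add_sub_eq (g₁ + g₂) (K (g₁ + g₂))
    have hx := horth x (-A† x) (mem_graph_boundaryConditionOperator.mpr
      ⟨x.2, by rw [Subtype.coe_eta, hx1, hx2], rfl⟩)
    have hgreen := hΓ.green ⟨v, hvd⟩ x
    rw [hAdj, inner_smul_left, Complex.conj_ofReal, ← hg₁, ← hg₂] at hgreen
    rw [inner_sub_right, inner_smul_right, inner_neg_right, sub_neg_eq_add, hgreen] at hx
    have hkey : inner ℂ (g₁ + g₂) (g₁ + g₂) = inner ℂ (g₁ - g₂) (K (g₁ + g₂)) := by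
      nth_rewrite 2 [← hx1]
      rw [← hx2]
      simp only [inner_add_left, inner_add_right, inner_sub_left, inner_sub_right]
      linear_combination 2 * hx
    have hnorm : ‖g₁ + g₂‖ * ‖g₁ + g₂‖ ≤ ‖g₁ - g₂‖ * ‖g₁ + g₂‖ := by
      have h1 : ‖(inner ℂ (g₁ + g₂) (g₁ + g₂) : ℂ)‖ = ‖g₁ + g₂‖ * ‖g₁ + g₂‖ := by
        rw [inner_self_eq_norm_sq_to_K]; simp [sq]
      rw [← h1, hkey]
      refine (norm_inner_le_norm _ _).trans ?_
      gcongr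
      simpa using K.le_of_opNorm_le hK (g₁ + g₂)
    have hle' : ‖g₁ + g₂‖ ^ 2 ≤ ‖g₁ - g₂‖ ^ 2 := by
      nlinarith [norm_nonneg (g₁ + g₂), norm_nonneg (g₁ - g₂),
        sq_nonneg (‖g₁ + g₂‖ - ‖g₁ - g₂‖)]
    have h1 := norm_add_sq_eq_norm_sub_sq_add g₁ g₂
    have h2 := hΓ.re_inner_adjoint_apply ⟨v, hvd⟩
    have h3 : (inner ℂ v v).re = ‖v‖ ^ 2 := inner_self_eq_norm_sq (𝕜 := ℂ) v
    rw [hAdj, inner_smul_left, Complex.conj_ofReal, Complex.re_ofReal_mul, h3, ← hg₁, ← hg₂] at h2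
    by_contra hne
    have h4 : 0 < ‖v‖ := norm_pos_iff.mpr hne
    have h5 : 0 < r * ‖v‖ ^ 2 := by positivity
    linarith
  obtain ⟨⟨⟨x, y⟩, hp⟩, he⟩ := htop.ge (Submodule.mem_top (x := z))
  exact ⟨x, y, hp, he⟩

end IsBoundaryTriplet

end BoundaryTriplet

theorem theorem4p2 {X H : Type*}
    [NormedAddCommGroup X] [InnerProductSpace ℂ X] [CompleteSpace X]
    [NormedAddCommGroup H] [InnerProductSpace ℂ H] [CompleteSpace H]
    (A : X →ₗ.[ℂ] X) (hAclosed : A.IsClosed) (hAskew : IsSkewSymmetric A)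
    (Γ₁ Γ₂ : A†.domain →ₗ[ℂ] H) (hΓ : IsBoundaryTriplet A Γ₁ Γ₂)
    (B : X →ₗ.[ℂ] X) (hAB : A ≤ B) :
    GeneratesContractionSemigroup B ↔
      ∃! K : H →L[ℂ] H, ‖K‖ ≤ 1 ∧
        (B.domain : Set X) =
          {x : X | ∃ hx : x ∈ A†.domain,
            (K - 1) (Γ₁ ⟨x, hx⟩) + (K + 1) (Γ₂ ⟨x, hx⟩) = 0} ∧
        B = (-A†).domRestrict B.domain := by
  simp only [← eq_boundaryConditionOperator_iff]
  constructor
  · intro hgen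
    have hdiss := hgen.isDissipative
    obtain ⟨K, hK, hle⟩ :=
      hΓ.exists_le_boundaryConditionOperator (hAskew.le_neg_adjoint hAB hdiss) hdiss
    have heq := (hΓ.boundaryConditionOperator_isDissipative hK).eq_of_le hle
      hgen.surjective_one_sub
    exact ⟨K, ⟨hK, heq⟩, fun K' h' => hΓ.boundaryConditionOperator_injective (h'.2.symm.trans heq)⟩
  · rintro ⟨K, ⟨hK, rfl⟩, -⟩
    exact (hΓ.boundaryConditionOperator_isDissipative hK).generatesContractionSemigroup
      (hAskew.1.mono hAB.1)
      fun r hr => hΓ.surjective_smul_sub_boundaryConditionOperator hAskew hAB hK hr
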